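/- Let $G$ be a connected nilpotent (real, finite-dimensional) Lie group, let $n \ge 0$, and let $\mathrm{Aff}(n)$ be the group of affine transformations $x \mapsto gx + t$ ($g \in \mathrm{GL}(n,\mathbb{R})$, $t \in \mathbb{R}^n$) of real affine space $\mathbb{A}^n = \mathbb{R}^n$, regarded as the subgroup of $\mathrm{GL}(n+1,\mathbb{R})$ of matrices $\begin{pmatrix} g & t \\ 0 & 1 \end{pmatrix}$; write $\ell : \mathrm{Aff}(n) \to \mathrm{GL}(n,\mathbb{R})$ for the linear part $\ell(x \mapsto gx+t) = g$. Let $\rho : G \to \mathrm{Aff}(n)$ be an affine representation, i.e. a (smooth) homomorphism of Lie groups, and suppose that $\rho$ is prehomogeneous, i.e. there is a point $x \in \mathbb{A}^n$ whose orbit $\rho(G)x$ is open in $\mathbb{A}^n$. Then the following are equivalent: (i) $\rho$ is transitive, i.e. $\rho(G)$ acts transitively on $\mathbb{A}^n$; (ii) $\rho(G)$ is unipotent, i.e. as a subgroup of $\mathrm{GL}(n+1,\mathbb{R})$ it is conjugate to a subgroup of the group of upper triangular matrices with all diagonal entries equal to $1$; (iii) $\rho$ is volume preserving, i.e. $\ell(\rho(G))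 \subseteq \mathrm{SL}(n,\mathbb{R})$. -/

import Mathlib

open scoped Manifold ContDiff

namespace AffineRep

/-- The real affine space of dimension `n`, with its standard coordinates. -/
abbrev Space (n : ℕ) : Type := EuclideanSpace ℝ (Fin n)

/-- The group of affine transformations of affine `n`-space. -/
abbrev Aff (n : ℕ) : Type := Space n ≃ᵃ[ℝ] Space n

/-- The coordinate representation of an affine transformation `x ↦ g x + t` as the
`(n + 1) × (n + 1)` matrix with blocks `g`, `t` in the first `n` rows and `0`, `1` in the last. -/
noncomputable def toMatrix {n : ℕ} (A : Aff n) : Matrix (Fin (n + 1)) (Fin (n + 1)) ℝ :=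
  Matrix.reindex finSumFinEquiv finSumFinEquiv
    (Matrix.fromBlocks
      (Matrix.of fun i j : Fin n => A.linear (EuclideanSpace.single j 1) i)
      (Matrix.of fun (i : Fin n) (_ : Fin 1) => A 0 i)
      0 1)

theorem linear_apply_eq_sum {n : ℕ} (A : Aff n) (v : Space n) (i : Fin n) :
    A.linear v i = ∑ j, A.linear (EuclideanSpace.single j 1) i * v j := by
  have hv : v = ∑ j, v j • (EuclideanSpace.single j (1 : ℝ) : Space n) := by
    ext k
    simp [Pi.single_apply]
  conv_lhs => rw [hv]
  simp [map_sum, mul_comm]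

theorem apply_eq_linear_add {n : ℕ} (A : Aff n) (x : Space n) : A x = A.linear x + A 0 := by
  simpa using A.map_vadd 0 x

theorem toMatrix_one (n : ℕ) : toMatrix (1 : Aff n) = 1 := by
  have h : (Matrix.of fun i j : Fin n =>
      (1 : Aff n).linear (EuclideanSpace.single j 1) i) = (1 : Matrix (Fin n) (Fin n) ℝ) := by
    ext i j
    simp [AffineEquiv.one_def, Matrix.one_apply]
  have h' : (Matrix.of fun (i : Fin n) (_ : Fin 1) => (1 : Aff n) 0 i) = 0 := by
    ext i j
    simp
  rw [toMatrix, h, h', Matrix.fromBlocks_one]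
  simp

theorem toMatrix_mul {n : ℕ} (A B : Aff n) : toMatrix (A * B) = toMatrix A * toMatrix B := by
  simp only [toMatrix, Matrix.reindex_apply, Matrix.submatrix_mul_equiv,
    Matrix.fromBlocks_multiply]
  congr 2
  · ext i j
    simp only [Matrix.of_apply, Matrix.mul_zero, add_zero, Matrix.mul_apply]
    exact linear_apply_eq_sum A _ i
  · ext i j
    simp only [Matrix.of_apply, Matrix.mul_one, Matrix.add_apply, Matrix.mul_apply,
      AffineEquiv.coe_mul, Function.comp_apply]
    rw [apply_eq_linear_add A (B 0), PiLp.add_apply, linear_apply_eq_sum]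
  · simp
  · simp

/-- The embedding of the affine group into the general linear group of degree `n + 1`. -/
noncomputable def toGL (n : ℕ) : Aff n →* GL (Fin (n + 1)) ℝ :=
  MonoidHom.toHomUnits
    { toFun := toMatrix
      map_one' := toMatrix_one n
      map_mul' := toMatrix_mul }

/-- A subgroup of `GL(m, ℝ)` is unipotent if it is conjugate to a subgroup of the group of upper
triangular matrices with all diagonal entries equal to `1`. -/
def IsUnipotent {m : ℕ} (S : Subgroup (GL (Fin m) ℝ)) : Prop :=
  ∃ P : GL (Fin m) ℝ, ∀ A ∈ S,
    (∀ i, (P * A * P⁻¹).val i i = 1) ∧ ∀ i j, j < i → (P * A * P⁻¹).val i j = 0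

variable {G : Type*} [Group G] {n : ℕ}

/-- A homomorphism into `Aff n`, viewed inside `GL(n + 1, ℝ)`, is smooth if its matrix
entries are smooth functions. -/
def IsSmooth {E : Type*} [NormedAddCommGroup E] [NormedSpace ℝ E]
    [TopologicalSpace G] [ChartedSpace E G] (ρ : G →* Aff n) : Prop :=
  ∀ i j, ContMDiff 𝓘(ℝ, E) 𝓘(ℝ, ℝ) ∞ fun g : G => (toGL n (ρ g)).val i j

/-- The affine representation has an open orbit. -/
def IsPrehomogeneous (ρ : G →* Aff n) : Prop :=
  ∃ x : Space n, IsOpen (Set.range fun g : G => ρ g x)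

/-- The affine representation acts transitively on the whole affine space. -/
def IsTransitive (ρ : G →* Aff n) : Prop :=
  ∀ x y : Space n, ∃ g : G, ρ g x = y

/-- The linear part of the affine representation takes its values in the special linear group. -/
def IsVolumePreserving (ρ : G →* Aff n) : Prop :=
  ∀ g : G, LinearMap.det ((ρ g).linear : Space n →ₗ[ℝ] Space n) = 1

end AffineRep

/-! View affine space as the hyperplane `e = 1` in `V = ℝ^(n+1)`, where `e` is the last coordinate;
`G` acts linearly and preserves `e`. Openness of the orbit of `x` is used only along lines through
`x`, a form that passes to quotients. It forces a stable subspace containing `x` to be all of `V`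
(`IsRadiallyOpenAt.eq_top`).

The key fact is that, for `G` connected nilpotent, both summands of the Fitting decomposition `V =
V₁ ⊕ V₂` of `ρ z - 1` are `G`-stable (`isStable_maxGenEigenspace`, `isStable_iInf_range_pow`).
Invariance of `e` gives `e = 0` on `V₂`, so the component `x₁` of `x` stays in the hyperplane.

Transitive implies unipotent: the orbit of `x₁` is the whole hyperplane, so `V₁ = V` for every `z`.
Volume preserving implies unipotent: if `x₂ ≠ 0`, some `g` moves `x` slightly in the direction `x₂`;
by stability it fixes `x₁` and scales `x₂` by `t > 1`, so `det (ρ g)` is a positive power of `t`, a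
contradiction. Unipotent implies transitive by induction on dimension, dividing by a fixed vector in
`ker e` (`IsUnipotent.exists_apply_eq_add`). Unipotent matrices have determinant one. -/

open scoped TensorProduct

namespace Representation

/-! ### Minimal stable subspaces and fixed vectors. -/

section Field

variable {k G V : Type*} [Field k] [Group G] [AddCommGroup V] [Module k V]

/-- All matrix coefficients of the representation are continuous. -/
def IsWeaklyContinuous [TopologicalSpace k] [TopologicalSpace G]
    (ρ : Representation k G V) : Prop :=
  ∀ (f : Module.Dual k V) (v : V), Continuous fun g => f (ρ g v)

/-- The submodule is stable under the action of every group element. -/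
def IsStable (ρ : Representation k G V) (U : Submodule k V) : Prop :=
  ∀ g, U ≤ U.comap (ρ g)

/-- The submodule is minimal among the nonzero stable submodules. -/
def IsMinimalStable (ρ : Representation k G V) (U : Submodule k V) : Prop :=
  Minimal (fun W => W ≠ ⊥ ∧ ρ.IsStable W) U

/-- Every element of the group acts by a unipotent transformation. -/
def IsUnipotent (ρ : Representation k G V) : Prop :=
  ∀ g v, ∃ m : ℕ, ((ρ g - 1) ^ m) v = 0

theorem apply_mul (ρ : Representation k G V) (g h : G) (v : V) : ρ (g * h) v = ρ g (ρ h v) := by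
  rw [map_mul]; rfl

theorem exists_isMinimalStable_le [FiniteDimensional k V] (ρ : Representation k G V)
    {U : Submodule k V} (hU : U ≠ ⊥) (hs : ρ.IsStable U) :
    ∃ W ≤ U, ρ.IsMinimalStable W :=
  exists_minimal_le_of_wellFoundedLT (fun W => W ≠ ⊥ ∧ ρ.IsStable W) U ⟨hU, hs⟩

/-- The vectors of `U` all of whose translates satisfy the eigenvalue equation form a stable
subspace, nonzero because of `u₀`; minimality makes it `U`. -/
theorem IsMinimalStable.apply_eq_smul {ρ : Representation k G V} {U : Submodule k V}
    (hU : ρ.IsMinimalStable U) {z : G} {μ : k} {u₀ : V} (hu₀ : u₀ ∈ U) (hne : u₀ ≠ 0)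
    (h : ∀ g, ρ z (ρ g u₀) = μ • ρ g u₀) {u : V} (hu : u ∈ U) : ρ z u = μ • u := by
  let W : Submodule k V :=
    { carrier := {u | u ∈ U ∧ ∀ g, ρ z (ρ g u) = μ • ρ g u}
      add_mem' := fun {a b} ha hb =>
        ⟨U.add_mem ha.1 hb.1, fun g => by simp only [map_add, ha.2, hb.2, smul_add]⟩
      zero_mem' := ⟨U.zero_mem, fun g => by simp⟩
      smul_mem' := fun c a ha =>
        ⟨U.smul_mem c ha.1, fun g => by simp only [map_smul, ha.2]; rw [smul_comm]⟩ }
  have hW : W ≠ ⊥ := fun hb => hne ((Submodule.eq_bot_iff _).1 hb u₀ ⟨hu₀, h⟩)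
  have hWs : ρ.IsStable W := fun g u hu =>
    ⟨hU.prop.2 g hu.1, fun g' => by simpa only [apply_mul] using hu.2 (g' * g)⟩
  have := (hU.le_of_le ⟨hW, hWs⟩ (fun u hu => hu.1) hu).2 1
  simpa using this

/-- A nilpotent group of unipotent transformations fixes a nonzero vector in every nonzero stable
submodule. -/
theorem exists_fixed_mem [FiniteDimensional k V] [Group.IsNilpotent G] (ρ : Representation k G V)
    (hρ : ρ.IsUnipotent) {U : Submodule k V} (hU : U ≠ ⊥)
    (hs : ρ.IsStable U) : ∃ v ∈ U, v ≠ 0 ∧ ∀ g, ρ g v = v := by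
  obtain ⟨W, hWU, hW⟩ := exists_isMinimalStable_le ρ hU hs
  -- Climb the upper central series. Unipotence gives `z` a nonzero fixed vector in `W`; commutators
  -- `[z, g]` act trivially by induction, so `z` fixes its translates too.
  have key : ∀ (i : ℕ), ∀ z ∈ Subgroup.upperCentralSeries G i, ∀ u ∈ W, ρ z u = u := by
    intro i
    induction i with
    | zero =>
      intro z hz u _
      rw [Subgroup.upperCentralSeries_zero, Subgroup.mem_bot] at hz
      simp [hz]
    | succ i ih =>
      intro z hz u hu
      rw [Subgroup.mem_upperCentralSeries_succ_iff] at hz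
      obtain ⟨w, hw, hw0⟩ := (Submodule.ne_bot_iff _).1 hW.prop.1
      have hex := hρ z w
      classical
      have hm := Nat.find_spec hex
      have hm0 : Nat.find hex ≠ 0 := fun h0 => hw0 (by simpa [h0] using hm)
      obtain ⟨m, hm'⟩ := Nat.exists_eq_succ_of_ne_zero hm0
      have hmem : ∀ m : ℕ, ((ρ z - 1) ^ m) w ∈ W := by
        intro m
        induction m with
        | zero => simpa using hw
        | succ m ihm =>
          rw [pow_succ', Module.End.mul_apply]
          exact W.sub_mem (hW.prop.2 z ihm) ihm
      have hu₀ : ρ z (((ρ z - 1) ^ m) w) = ((ρ z - 1) ^ m) w := by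
        rw [hm', pow_succ', Module.End.mul_apply] at hm
        exact sub_eq_zero.1 hm
      have hne : ((ρ z - 1) ^ m) w ≠ 0 := Nat.find_min hex (by omega)
      have := hW.apply_eq_smul (μ := 1) (z := z) (hmem m) hne (fun g => ?_) hu
      · simpa using this
      · have h1 := ih _ (hz g) (ρ g (ρ z (((ρ z - 1) ^ m) w)))
          (hW.prop.2 g (hW.prop.2 z (hmem m)))
        rw [← apply_mul, ← apply_mul, commutatorElement_def,
          show z * g * z⁻¹ * g⁻¹ * g * z = z * g by group, apply_mul, hu₀] at h1
        rw [h1, one_smul]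
  obtain ⟨N, hN⟩ := Group.IsNilpotent.nilpotent G
  obtain ⟨w, hw, hw0⟩ := (Submodule.ne_bot_iff _).1 hW.prop.1
  exact ⟨w, hWU hw, hw0, fun g => key N g (by simp [hN]) w hw⟩

end Field

/-! ### Common eigenvectors of connected nilpotent groups. -/

theorem IsWeaklyContinuous.of_apply {k G V : Type*} [NormedField k] [Group G]
    [TopologicalSpace G] [AddCommGroup V] [Module k V] [FiniteDimensional k V]
    {ρ : Representation k G V} (hρ : ρ.IsWeaklyContinuous) (f : Module.Dual k V)
    {w : G → V} (hw : ∀ f : Module.Dual k V, Continuous fun g => f (w g)) {φ : G → G}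
    (hφ : Continuous φ) : Continuous fun g => f (ρ (φ g) (w g)) := by
  let b := Module.finBasis k V
  have : (fun g => f (ρ (φ g) (w g))) =
      fun g => ∑ i, b.coord i (w g) * f (ρ (φ g) (b i)) := by
    ext g
    conv_lhs => rw [← b.sum_repr (w g)]
    simp only [map_sum, map_smul, smul_eq_mul, Module.Basis.coord_apply]
  rw [this]
  exact continuous_finsetSum _ fun i _ => (hw _).mul ((hρ f (b i)).comp hφ)

theorem eq_of_finite_range {G k : Type*} [TopologicalSpace G] [PreconnectedSpace G]
    [TopologicalSpace k] [T1Space k] {d : G → k} (hd : Continuous d) {s : Set k} (hs : s.Finite)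
    (h : ∀ g, d g ∈ s) (g g' : G) : d g = d g' := by
  exact isPreconnected_univ.constant_of_mapsTo (T := s) hs.isDiscrete hd.continuousOn
    (fun g _ => h g) (Set.mem_univ g) (Set.mem_univ g')

/-- A connected nilpotent group of complex linear transformations has a common eigenvector. -/
theorem exists_common_eigenvector {G V : Type*} [Group G] [TopologicalSpace G]
    [IsTopologicalGroup G] [ConnectedSpace G] [Group.IsNilpotent G] [AddCommGroup V] [Module ℂ V]
    [FiniteDimensional ℂ V] [Nontrivial V] {ρ : Representation ℂ G V}
    (hρ : ρ.IsWeaklyContinuous) : ∃ v ≠ 0, ∃ χ : G →* ℂ, ∀ g, ρ g v = χ g • v := by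
  obtain ⟨W, -, hW⟩ := exists_isMinimalStable_le ρ (U := ⊤) top_ne_bot (fun g => by simp)
  have key : ∀ (i : ℕ), ∀ z ∈ Subgroup.upperCentralSeries G i, ∃ c : ℂ, ∀ u ∈ W,
      ρ z u = c • u := by
    intro i
    induction i with
    | zero =>
      intro z hz
      rw [Subgroup.upperCentralSeries_zero, Subgroup.mem_bot] at hz
      exact ⟨1, fun u _ => by simp [hz]⟩
    | succ i ih =>
      intro z hz
      rw [Subgroup.mem_upperCentralSeries_succ_iff] at hz
      have : Nontrivial W := Submodule.nontrivial_iff_ne_bot.2 hW.prop.1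
      obtain ⟨μ, hμ⟩ := Module.End.exists_eigenvalue ((ρ z).restrict (hW.prop.2 z))
      obtain ⟨⟨u₀, hu₀⟩, hμu⟩ := hμ.exists_hasEigenvector
      have hne : u₀ ≠ 0 := fun h => hμu.2 (by simpa using h)
      have hz₀ : ρ z u₀ = μ • u₀ := by simpa using congrArg Subtype.val hμu.apply_eq_smul
      -- Since `z g = [z, g] g z` and `[z, g]` is scalar on `W`, each translate of `u₀` is again an
      -- eigenvector of `z`.
      have hd : ∀ g, ∃ d : ℂ, ρ z (ρ g u₀) = d • ρ g u₀ := by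
        intro g
        obtain ⟨c, hc⟩ := ih _ (hz g)
        have h1 := hc _ (hW.prop.2 g (hW.prop.2 z hu₀))
        rw [← apply_mul, ← apply_mul, commutatorElement_def,
          show z * g * z⁻¹ * g⁻¹ * g * z = z * g by group, apply_mul, hz₀] at h1
        exact ⟨c * μ, by rw [h1, map_smul, smul_smul]⟩
      choose d hd using hd
      have hgne : ∀ g, ρ g u₀ ≠ 0 := fun g h0 => hne (by
        have := congrArg (ρ g⁻¹) h0
        rwa [← apply_mul, inv_mul_cancel, map_one, map_zero] at this)
      have hdc : Continuous d := by
        obtain ⟨f, hf⟩ : ∃ f : Module.Dual ℂ V, f u₀ = 1 := 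
          Module.Projective.exists_dual_eq_one ℂ hne
        have : d = fun g => f (ρ g⁻¹ (ρ z (ρ g u₀))) := by
          ext g
          rw [hd, map_smul, ← apply_mul, inv_mul_cancel, map_one, map_smul]
          simp [hf]
        rw [this]
        exact hρ.of_apply f (fun f' => hρ (f' ∘ₗ ρ z) u₀) continuous_inv
      -- A continuous function from a connected group to the finite spectrum of `ρ z` is constant.
      have hdfin : ∀ g, d g = μ := by
        intro g
        rw [eq_of_finite_range hdc
          (s := {μ | Module.End.HasEigenvalue (ρ z) μ}) (Module.End.finite_hasEigenvalue _)
          (fun g => Module.End.hasEigenvalue_of_hasEigenvector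
            ⟨Module.End.mem_eigenspace_iff.2 (hd g), hgne g⟩) g 1]
        have := hd 1
        rw [map_one, Module.End.one_apply, hz₀] at this
        exact (smul_left_injective ℂ hne this).symm
      exact ⟨μ, fun u hu => hW.apply_eq_smul hu₀ hne (fun g => by rw [hd, hdfin]) hu⟩
  obtain ⟨N, hN⟩ := Group.IsNilpotent.nilpotent G
  obtain ⟨w, hw, hw0⟩ := (Submodule.ne_bot_iff _).1 hW.prop.1
  have hχ : ∀ g, ∃ c : ℂ, ρ g w = c • w := fun g => by
    obtain ⟨c, hc⟩ := key N g (by simp [hN])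
    exact ⟨c, hc w hw⟩
  choose χ hχ using hχ
  refine ⟨w, hw0, ⟨⟨χ, ?_⟩, ?_⟩, hχ⟩
  · apply smul_left_injective ℂ hw0
    simp [← hχ]
  · intro g h
    apply smul_left_injective ℂ hw0
    change χ (g * h) • w = (χ g * χ h) • w
    rw [← hχ, apply_mul, hχ h, map_smul, hχ g, smul_smul, mul_comm]

/-! ### Quotients, complexification and duals. -/

/-- Transports generalized eigenvectors. `T` is a bare map between modules over possibly different
rings, so that `v ↦ 1 ⊗ v` from `V` to its complexification is covered. -/
theorem map_pow_apply_of_semiconj {R S V W : Type*} [Semiring R] [Semiring S] [AddCommMonoid V]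
    [AddCommMonoid W] [Module R V] [Module S W] {A : Module.End R V} {B : Module.End S W}
    {T : V → W} (h : ∀ v, T (A v) = B (T v)) (k : ℕ) (v : V) : T ((A ^ k) v) = (B ^ k) (T v) := by
  induction k generalizing v with
  | zero => rfl
  | succ k ih => rw [pow_succ, pow_succ, Module.End.mul_apply, Module.End.mul_apply, ih, h]

theorem quotient_apply_mk {k G V : Type*} [Field k] [Group G] [AddCommGroup V] [Module k V]
    (ρ : Representation k G V) {L : Submodule k V} (hL : ρ.IsStable L) (g : G) (v : V) :
    ρ.quotient L hL g (L.mkQ v) = L.mkQ (ρ g v) := rfl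

theorem IsWeaklyContinuous.quotient {k G V : Type*} [Field k] [Group G] [TopologicalSpace k]
    [TopologicalSpace G] [AddCommGroup V] [Module k V] {ρ : Representation k G V}
    (hρ : ρ.IsWeaklyContinuous) {L : Submodule k V} (hL : ρ.IsStable L) :
    (ρ.quotient L hL).IsWeaklyContinuous := by
  intro f v
  obtain ⟨v, rfl⟩ := L.mkQ_surjective v
  exact hρ (f ∘ₗ L.mkQ) v

/-- The complexification of a real representation. -/
noncomputable def complexify {G V : Type*} [Group G] [AddCommGroup V] [Module ℝ V]
    (ρ : Representation ℝ G V) : Representation ℂ G (ℂ ⊗[ℝ] V) :=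
  (Module.End.baseChangeHom ℝ ℂ V : Module.End ℝ V →* Module.End ℂ (ℂ ⊗[ℝ] V)).comp ρ

theorem complexify_apply_tmul {G V : Type*} [Group G] [AddCommGroup V] [Module ℝ V]
    (ρ : Representation ℝ G V) (g : G) (a : ℂ) (v : V) :
    ρ.complexify g (a ⊗ₜ v) = a ⊗ₜ ρ g v := rfl

theorem IsWeaklyContinuous.complexify {G V : Type*} [Group G] [TopologicalSpace G]
    [AddCommGroup V] [Module ℝ V] {ρ : Representation ℝ G V} (hρ : ρ.IsWeaklyContinuous) :
    ρ.complexify.IsWeaklyContinuous := by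
  intro f v
  induction v with
  | zero => simpa using continuous_const
  | add x y hx hy =>
    simp only [map_add]
    exact hx.add hy
  | tmul a v =>
    have hre : Continuous fun g => (f (a ⊗ₜ ρ g v)).re :=
      hρ (Complex.reLm ∘ₗ f.restrictScalars ℝ ∘ₗ TensorProduct.mk ℝ ℂ V a) v
    have him : Continuous fun g => (f (a ⊗ₜ ρ g v)).im :=
      hρ (Complex.imLm ∘ₗ f.restrictScalars ℝ ∘ₗ TensorProduct.mk ℝ ℂ V a) v
    have : (fun g => f (ρ.complexify g (a ⊗ₜ v))) = fun g =>
        ((f (a ⊗ₜ ρ g v)).re : ℂ) + ((f (a ⊗ₜ ρ g v)).im : ℂ) * Complex.I := by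
      ext g
      rw [Complex.re_add_im, complexify_apply_tmul]
    rw [this]
    fun_prop

theorem IsWeaklyContinuous.dual {G V : Type*} [Group G] [TopologicalSpace G]
    [IsTopologicalGroup G] [AddCommGroup V] [Module ℝ V] [FiniteDimensional ℝ V]
    {ρ : Representation ℝ G V} (hρ : ρ.IsWeaklyContinuous) : ρ.dual.IsWeaklyContinuous := by
  intro φ f
  obtain ⟨v, rfl⟩ := (Module.evalEquiv ℝ V).surjective φ
  exact (hρ f v).comp continuous_inv

/-! ### Stability of the Fitting components. -/

section ConnectedNilpotent

variable {G : Type*} [Group G] [TopologicalSpace G] [IsTopologicalGroup G] [ConnectedSpace G]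
  [Group.IsNilpotent G]

/-- Multiplying `z` by an element `c` that every linear character kills does not change its
generalized eigenvalues on a subspace stable under both. -/
theorem le_maxGenEigenspace_mul {c : G} (hc : ∀ χ : G →* ℂ, χ c = 1) (z : G) (μ : ℂ) :
    ∀ (d : ℕ) {V : Type*} [AddCommGroup V] [Module ℂ V] [FiniteDimensional ℂ V],
      Module.finrank ℂ V = d → ∀ (ρ : Representation ℂ G V), ρ.IsWeaklyContinuous →
      ∀ U : Submodule ℂ V, U ≤ U.comap (ρ c) → U ≤ U.comap (ρ z) →
      U ≤ Module.End.maxGenEigenspace (ρ z) μ → U ≤ Module.End.maxGenEigenspace (ρ (c * z)) μ := by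
  intro d
  induction d with
  | zero =>
    intro V _ _ _ hd ρ _ U _ _ _ u _
    have := Module.finrank_zero_iff.1 hd
    rw [Subsingleton.elim u 0]
    exact zero_mem _
  | succ d ih =>
    intro V _ _ _ hd ρ hρ U hUc hUz hU u hu
    have : Nontrivial V := Module.nontrivial_of_finrank_pos (R := ℂ) (by omega)
    obtain ⟨v, hv, χ, hχ⟩ := exists_common_eigenvector hρ
    have hL : ρ.IsStable (ℂ ∙ v) := by
      intro g w hw
      obtain ⟨a, rfl⟩ := Submodule.mem_span_singleton.1 hw
      exact Submodule.mem_span_singleton.2 ⟨a * χ g, by rw [map_smul, hχ, smul_smul]⟩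
    have hfin : Module.finrank ℂ (V ⧸ (ℂ ∙ v)) = d := by
      have := (ℂ ∙ v).finrank_quotient_add_finrank
      rw [finrank_span_singleton hv] at this
      omega
    have hsemi : ∀ g w, (ℂ ∙ v).mkQ ((ρ g - μ • (1 : Module.End ℂ V)) w) =
        (ρ.quotient _ hL g - μ • (1 : Module.End ℂ (V ⧸ (ℂ ∙ v)))) ((ℂ ∙ v).mkQ w) := by
      intro g w
      rfl
    have hq := ih hfin (ρ.quotient _ hL) (hρ.quotient hL) (U.map (ℂ ∙ v).mkQ)
      (by rintro _ ⟨w, hw, rfl⟩; exact ⟨ρ c w, hUc hw, rfl⟩)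
      (by rintro _ ⟨w, hw, rfl⟩; exact ⟨ρ z w, hUz hw, rfl⟩)
      (by
        rintro _ ⟨w, hw, rfl⟩
        obtain ⟨k, hk⟩ := (Module.End.mem_maxGenEigenspace _ _ _).1 (hU hw)
        exact (Module.End.mem_maxGenEigenspace _ _ _).2
          ⟨k, by rw [← map_pow_apply_of_semiconj (hsemi z), hk, map_zero]⟩)
      ⟨u, hu, rfl⟩
    obtain ⟨k, hk⟩ := (Module.End.mem_maxGenEigenspace _ _ _).1 hq
    rw [← map_pow_apply_of_semiconj (hsemi (c * z)), Submodule.mkQ_apply,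
      Submodule.Quotient.mk_eq_zero] at hk
    have hpow : ∀ k : ℕ, ((ρ (c * z) - μ • (1 : Module.End ℂ V)) ^ k) u ∈ U := by
      intro k
      induction k with
      | zero => exact hu
      | succ k ihk =>
        rw [pow_succ', Module.End.mul_apply]
        refine U.sub_mem ?_ (U.smul_mem _ ihk)
        rw [apply_mul]
        exact hUc (hUz ihk)
    set w := ((ρ (c * z) - μ • (1 : Module.End ℂ V)) ^ k) u with hw
    -- By induction `w` lies on the line of the common eigenvector `v`. If `w ≠ 0`, then `w ∈ U`
    -- forces `χ z = μ`, so `χ (c * z) = μ` and one further factor kills `w`.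
    refine (Module.End.mem_maxGenEigenspace _ _ _).2 ⟨k + 1, ?_⟩
    rw [pow_succ', Module.End.mul_apply, ← hw]
    by_cases hw0 : w = 0
    · rw [hw0, map_zero]
    have hzw : ∀ g, ρ g w = χ g • w := by
      intro g
      obtain ⟨a, ha⟩ := Submodule.mem_span_singleton.1 hk
      rw [← ha, map_smul, hχ, smul_comm]
    obtain ⟨m, hm⟩ := (Module.End.mem_maxGenEigenspace _ _ _).1 (hU (hpow k))
    have hpw : ∀ m : ℕ, ((ρ z - μ • (1 : Module.End ℂ V)) ^ m) w = (χ z - μ) ^ m • w := by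
      intro m
      induction m with
      | zero => simp
      | succ m ihm =>
        rw [pow_succ', Module.End.mul_apply, ihm, map_smul, LinearMap.sub_apply, hzw,
          LinearMap.smul_apply, Module.End.one_apply, ← sub_smul, smul_smul, pow_succ]
    rw [← hw, hpw] at hm
    have hχμ : χ z = μ := by
      rcases smul_eq_zero.1 hm with h | h
      · exact sub_eq_zero.1 (eq_zero_of_pow_eq_zero h)
      · exact absurd h hw0
    rw [LinearMap.sub_apply, hzw, map_mul, hc, hχμ]
    simp

/-- Write `g⁻¹ z g = c z`. The commutator `c` lies one step lower in the upper central series than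
`g`, so by induction it preserves the eigenspace, and every character kills it. Hence the eigenspace
of `z` lies in that of `g⁻¹ z g`, which `g` carries into that of `z`. -/
theorem isStable_maxGenEigenspace_complex {V : Type*} [AddCommGroup V] [Module ℂ V]
    [FiniteDimensional ℂ V] {ρ : Representation ℂ G V} (hρ : ρ.IsWeaklyContinuous) (z : G)
    (μ : ℂ) : ρ.IsStable (Module.End.maxGenEigenspace (ρ z) μ) := by
  have key : ∀ (i : ℕ), ∀ g ∈ Subgroup.upperCentralSeries G i,
      Module.End.maxGenEigenspace (ρ z) μ ≤ (Module.End.maxGenEigenspace (ρ z) μ).comap (ρ g) := by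
    intro i
    induction i with
    | zero =>
      intro g hg
      rw [Subgroup.upperCentralSeries_zero, Subgroup.mem_bot] at hg
      intro v hv
      simpa [hg] using hv
    | succ i ih =>
      intro g hg v hv
      have hg' := Subgroup.inv_mem _ hg
      rw [Subgroup.mem_upperCentralSeries_succ_iff] at hg'
      have hc : g⁻¹ * z * g * z⁻¹ ∈ Subgroup.upperCentralSeries G i := by
        simpa [commutatorElement_def] using hg' z
      have hle := le_maxGenEigenspace_mul (c := g⁻¹ * z * g * z⁻¹)
        (fun χ => by
          rw [map_mul, map_mul, map_mul, mul_right_comm (χ g⁻¹),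
            ← map_mul, ← map_mul, ← map_mul]
          simp) z μ _ rfl ρ hρ (Module.End.maxGenEigenspace (ρ z) μ) (ih _ hc)
        (Module.End.mapsTo_maxGenEigenspace_of_comm (Commute.refl _) μ) le_rfl
      obtain ⟨k, hk⟩ := (Module.End.mem_maxGenEigenspace _ _ _).1 (hle hv)
      refine (Module.End.mem_maxGenEigenspace _ _ _).2 ⟨k, ?_⟩
      rw [← map_pow_apply_of_semiconj (T := ρ g)
        (A := ρ (g⁻¹ * z * g * z⁻¹ * z) - μ • (1 : Module.End ℂ V)), hk, map_zero]
      intro w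
      simp only [LinearMap.sub_apply, LinearMap.smul_apply, Module.End.one_apply, map_sub,
        map_smul, ← apply_mul]
      congr 3
      group
  obtain ⟨N, hN⟩ := Group.IsNilpotent.nilpotent G
  exact fun g => key N g (by simp [hN])

variable {V : Type*} [AddCommGroup V] [Module ℝ V] [FiniteDimensional ℝ V]
  {ρ : Representation ℝ G V}

/-- The generalized eigenspaces of an element of a connected nilpotent group are stable under the
whole group. -/
theorem isStable_maxGenEigenspace (hρ : ρ.IsWeaklyContinuous) (z : G) (μ : ℝ) :
    ρ.IsStable (Module.End.maxGenEigenspace (ρ z) μ) := by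
  have hsemi : ∀ v, (1 : ℂ) ⊗ₜ[ℝ] ((ρ z - μ • (1 : Module.End ℝ V)) v) =
      (ρ.complexify z - (μ : ℂ) • (1 : Module.End ℂ (ℂ ⊗[ℝ] V))) (1 ⊗ₜ v) := by
    intro v
    simp only [LinearMap.sub_apply, LinearMap.smul_apply, Module.End.one_apply,
      TensorProduct.tmul_sub, complexify_apply_tmul]
    rw [TensorProduct.smul_tmul', ← TensorProduct.smul_tmul]
    simp
  have hmem : ∀ v, v ∈ Module.End.maxGenEigenspace (ρ z) μ ↔
      (1 : ℂ) ⊗ₜ[ℝ] v ∈ Module.End.maxGenEigenspace (ρ.complexify z) (μ : ℂ) := by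
    intro v
    simp only [Module.End.mem_maxGenEigenspace, ← map_pow_apply_of_semiconj hsemi]
    refine exists_congr fun k => ⟨fun h => by rw [h, TensorProduct.tmul_zero], fun h => ?_⟩
    apply Module.Flat.tensorProduct_mk_injective (R := ℝ) (S := ℂ) (M := V)
    simpa using h
  intro g v hv
  rw [Submodule.mem_comap, hmem, ← complexify_apply_tmul]
  exact isStable_maxGenEigenspace_complex hρ.complexify z μ g ((hmem v).1 hv)

/-- By duality: a functional separating `ρ g v` from a range would be a generalized eigenvector of
the dual action, and so would its translate by `g⁻¹`, which therefore vanishes at `v`. -/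
theorem isStable_iInf_range_pow (hρ : ρ.IsWeaklyContinuous) (z : G) :
    ρ.IsStable (⨅ k : ℕ, LinearMap.range ((ρ z - 1) ^ k)) := by
  intro g v hv
  rw [Submodule.mem_iInf] at hv
  rw [Submodule.mem_comap, Submodule.mem_iInf]
  intro k
  by_contra hgv
  obtain ⟨f, hf, hfk⟩ := Submodule.exists_le_ker_of_notMem hgv
  -- The dual action involves an inverse, so `z⁻¹` acts by precomposition with `ρ z`.
  have hpow : ∀ (k : ℕ) (f : Module.Dual ℝ V),
      ((ρ.dual z⁻¹ - (1 : ℝ) • 1) ^ k) f = f ∘ₗ ((ρ z - 1) ^ k) := by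
    intro k
    induction k with
    | zero => intro f; rfl
    | succ k ih =>
      intro f
      rw [pow_succ, Module.End.mul_apply, ih, pow_succ']
      ext w
      simp [dual_apply, Module.Dual.transpose_apply]
  have hfmem : f ∈ Module.End.maxGenEigenspace (ρ.dual z⁻¹) 1 := by
    refine (Module.End.mem_maxGenEigenspace _ _ _).2 ⟨k, ?_⟩
    rw [hpow]
    ext w
    exact hfk ⟨w, rfl⟩
  obtain ⟨m, hm⟩ := (Module.End.mem_maxGenEigenspace _ _ _).1
    (isStable_maxGenEigenspace hρ.dual z⁻¹ 1 g⁻¹ hfmem)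
  rw [hpow] at hm
  obtain ⟨w, rfl⟩ := hv m
  have := LinearMap.congr_fun hm w
  simp only [dual_apply, inv_inv] at this
  exact hf this

end ConnectedNilpotent

/-! ### Unipotent representations: flags and orbits. -/

theorem IsUnipotent.quotient {k G V : Type*} [Field k] [Group G] [AddCommGroup V] [Module k V]
    {ρ : Representation k G V} (hρ : ρ.IsUnipotent) {L : Submodule k V} (hL : ρ.IsStable L) :
    (ρ.quotient L hL).IsUnipotent := by
  intro g v
  obtain ⟨v, rfl⟩ := L.mkQ_surjective v
  obtain ⟨m, hm⟩ := hρ g v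
  refine ⟨m, ?_⟩
  have hsemi : ∀ w, L.mkQ ((ρ g - 1) w) = (ρ.quotient L hL g - 1) (L.mkQ w) := fun w => rfl
  rw [← map_pow_apply_of_semiconj hsemi, hm, map_zero]

theorem isStable_span_singleton {k G V : Type*} [Field k] [Group G] [AddCommGroup V] [Module k V]
    {ρ : Representation k G V} {v : V} (hv : ∀ g, ρ g v = v) : ρ.IsStable (k ∙ v) := by
  intro g w hw
  obtain ⟨a, rfl⟩ := Submodule.mem_span_singleton.1 hw
  exact Submodule.mem_span_singleton.2 ⟨a, by rw [map_smul, hv]⟩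

/-- A nilpotent group of unipotent transformations is unitriangular in a suitable basis. -/
theorem IsUnipotent.exists_basis {k G V : Type*} [Field k] [Group G] [Group.IsNilpotent G]
    [AddCommGroup V] [Module k V] [FiniteDimensional k V] {ρ : Representation k G V}
    (hρ : ρ.IsUnipotent) {n : ℕ} (hn : Module.finrank k V = n) :
    ∃ b : Module.Basis (Fin n) k V, ∀ g i, ρ g (b i) - b i ∈ Submodule.span k (b '' Set.Iio i) := by
  have key : ∀ m ≤ n, ∃ v : Fin m → V, LinearIndependent k v ∧
      ∀ g i, ρ g (v i) - v i ∈ Submodule.span k (v '' Set.Iio i) := by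
    intro m
    induction m with
    | zero => exact fun _ => ⟨Fin.elim0, linearIndependent_empty_type, fun g i => i.elim0⟩
    | succ m ih =>
      intro hm
      obtain ⟨v, hv, hvg⟩ := ih (by omega)
      set S := Submodule.span k (Set.range v) with hS
      have hSs : ρ.IsStable S := by
        intro g
        rw [hS, Submodule.span_le]
        rintro _ ⟨i, rfl⟩
        have h1 := Submodule.span_mono (Set.image_subset_range v _) (hvg g i)
        have h2 := Submodule.add_mem _ h1 (Submodule.subset_span (Set.mem_range_self i))
        simpa using h2
      have hST : S ≠ ⊤ := by
        intro h
        have := finrank_span_eq_card hv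
        rw [← hS, h, finrank_top, Fintype.card_fin] at this
        omega
      have : Nontrivial (V ⧸ S) := Submodule.Quotient.nontrivial_iff.2 hST
      -- A fixed vector modulo the span so far lifts to the next vector of the flag.
      obtain ⟨w, -, hw0, hw⟩ := exists_fixed_mem (ρ.quotient S hSs) (hρ.quotient hSs)
        (U := ⊤) top_ne_bot (fun g => by simp)
      obtain ⟨w, rfl⟩ := S.mkQ_surjective w
      refine ⟨Fin.snoc v w, linearIndependent_finSnoc.2 ⟨hv, fun h => hw0 ?_⟩, ?_⟩
      · simpa using h
      · intro g i
        refine Fin.lastCases ?_ (fun j => ?_) i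
        · have h1 := hw g
          rw [quotient_apply_mk, ← sub_eq_zero, ← map_sub, Submodule.mkQ_apply,
            Submodule.Quotient.mk_eq_zero] at h1
          rw [Fin.snoc_last]
          refine Submodule.span_mono ?_ h1
          rintro _ ⟨j, rfl⟩
          exact ⟨j.castSucc, Fin.castSucc_lt_last j, by simp⟩
        · rw [Fin.snoc_castSucc]
          refine Submodule.span_mono ?_ (hvg g j)
          rintro _ ⟨l, hl, rfl⟩
          exact ⟨l.castSucc, by simpa using hl, by simp⟩
  obtain ⟨v, hv, hvg⟩ := key n le_rfl
  have hcard : Fintype.card (Fin n) = Module.finrank k V := by simp [hn]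
  rcases n.eq_zero_or_pos with rfl | hpos
  · have := Module.finrank_zero_iff.1 hn
    exact ⟨Module.Basis.empty V, fun g i => i.elim0⟩
  · have : Nonempty (Fin n) := ⟨⟨0, hpos⟩⟩
    refine ⟨basisOfLinearIndependentOfCardEqFinrank hv hcard, ?_⟩
    simpa using hvg

/-- The orbit of `x` contains a neighbourhood of `x` on every line through `x` whose direction is
killed by the functional `e`. -/
def IsRadiallyOpenAt {G V : Type*} [Group G] [AddCommGroup V] [Module ℝ V]
    (ρ : Representation ℝ G V) (e : Module.Dual ℝ V) (x : V) : Prop :=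
  ∀ w, e w = 0 → ∃ ε > 0, ∀ s : ℝ, |s| < ε → ∃ g, ρ g x = x + s • w

/-- Modulo a fixed vector `v` of `ker e` the target is reached by induction, with an error along
`v`. Some `h` translates `x` by a small multiple of `v`; as `v` is fixed, powers of `h` accumulate
these translations and cancel the error. -/
theorem IsUnipotent.exists_apply_eq_add {G : Type*} [Group G] [Group.IsNilpotent G] :
    ∀ (d : ℕ) {V : Type*} [AddCommGroup V] [Module ℝ V] [FiniteDimensional ℝ V],
      Module.finrank ℝ V = d → ∀ {ρ : Representation ℝ G V}, ρ.IsUnipotent →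
      ∀ {e : Module.Dual ℝ V}, (∀ g v, e (ρ g v) = e v) → ∀ {x : V},
      ρ.IsRadiallyOpenAt e x → ∀ {w : V}, e w = 0 → ∃ g, ρ g x = x + w := by
  intro d
  induction d with
  | zero =>
    intro V _ _ _ hd ρ _ e _ x _ w _
    have := Module.finrank_zero_iff.1 hd
    exact ⟨1, Subsingleton.elim _ _⟩
  | succ d ih =>
    intro V _ _ _ hd ρ hρ e he x hx w hw
    by_cases hker : LinearMap.ker e = ⊥
    · refine ⟨1, ?_⟩
      rw [LinearMap.ker_eq_bot'.1 hker w hw]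
      simp
    obtain ⟨v, hve, hv0, hv⟩ := exists_fixed_mem ρ hρ hker (fun g u hu => by
      rw [Submodule.mem_comap, LinearMap.mem_ker, he]; exact hu)
    rw [LinearMap.mem_ker] at hve
    have hL := isStable_span_singleton hv
    have hle : (ℝ ∙ v) ≤ LinearMap.ker e := (Submodule.span_singleton_le_iff_mem _ _).2 hve
    have hfin : Module.finrank ℝ (V ⧸ (ℝ ∙ v)) = d := by
      have := (ℝ ∙ v).finrank_quotient_add_finrank
      rw [finrank_span_singleton hv0] at this
      omega
    obtain ⟨g, hg⟩ := ih hfin (hρ.quotient hL) (e := (ℝ ∙ v).liftQ e hle)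
      (by
        intro g u
        obtain ⟨u, rfl⟩ := (ℝ ∙ v).mkQ_surjective u
        exact he g u)
      (x := (ℝ ∙ v).mkQ x)
      (by
        intro u hu
        obtain ⟨u, rfl⟩ := (ℝ ∙ v).mkQ_surjective u
        obtain ⟨ε, hε, h⟩ := hx u hu
        refine ⟨ε, hε, fun s hs => ?_⟩
        obtain ⟨g, hg⟩ := h s hs
        exact ⟨g, by rw [quotient_apply_mk, hg, map_add, map_smul]⟩)
      (w := (ℝ ∙ v).mkQ w) hw
    rw [quotient_apply_mk, ← map_add, ← sub_eq_zero, ← map_sub, Submodule.mkQ_apply,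
      Submodule.Quotient.mk_eq_zero] at hg
    obtain ⟨a, ha⟩ := Submodule.mem_span_singleton.1 hg
    obtain ⟨ε, hε, h⟩ := hx v hve
    -- The correction `-a` is split into `N` equal steps, each shorter than `ε`.
    obtain ⟨N, hN⟩ := exists_nat_gt (|a| / ε)
    have hNpos : (0 : ℝ) < N := lt_of_le_of_lt (by positivity) hN
    obtain ⟨h, hh⟩ := h (-a / N) (by
      rw [abs_div, abs_neg, Nat.abs_cast, div_lt_iff₀ hNpos, mul_comm]
      exact (div_lt_iff₀ hε).1 hN)
    have hpow : ∀ m : ℕ, ρ (h ^ m) x = x + ((m : ℝ) * (-a / N)) • v := by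
      intro m
      induction m with
      | zero => simp
      | succ m ihm =>
        rw [pow_succ', apply_mul, ihm, map_add, map_smul, hv, hh, add_assoc, ← add_smul]
        push_cast
        ring_nf
    refine ⟨g * h ^ N, ?_⟩
    rw [apply_mul, hpow, map_add, map_smul, hv, mul_div_cancel₀ _ hNpos.ne', neg_smul, ha]
    abel

/-! ### Determinants and spanning by open orbits. -/

/-- Evaluate the characteristic polynomial `X ^ d` of the nilpotent map `-(A - t)` at `t`. -/
theorem det_eq_pow_of_isNilpotent {K V : Type*} [Field K] [AddCommGroup V] [Module K V]
    [FiniteDimensional K V] {A : Module.End K V} {t : K}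
    (h : IsNilpotent (A - t • (1 : Module.End K V))) :
    LinearMap.det A = t ^ Module.finrank K V := by
  have h1 := LinearMap.eval_charpoly (-(A - t • (1 : Module.End K V))) t
  rw [h.neg.charpoly_eq_X_pow_finrank, Polynomial.eval_pow, Polynomial.eval_X] at h1
  rw [h1, Algebra.algebraMap_eq_smul_one]
  congr 1
  abel

/-- A transformation whose only generalized eigenvalues are `1` and `t` has determinant a power
of `t`. -/
theorem det_eq_pow_of_maxGenEigenspace {K V : Type*} [Field K] [AddCommGroup V] [Module K V]
    [FiniteDimensional K V] {A : Module.End K V} {t : K}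
    (hsup : Module.End.maxGenEigenspace A 1 ⊔ Module.End.maxGenEigenspace A t = ⊤) :
    LinearMap.det A = t ^ Module.finrank K (Module.End.maxGenEigenspace A t) := by
  have hle : Module.End.maxGenEigenspace A t ≤ (Module.End.maxGenEigenspace A t).comap A :=
    Module.End.mapsTo_maxGenEigenspace_of_comm (Commute.refl A) t
  -- On the subspace `A - t` is nilpotent; the quotient is covered by the generalized eigenspace of
  -- `1`, so `A - 1` is nilpotent there.
  rw [LinearMap.det_eq_det_mul_det (Module.End.maxGenEigenspace A t) A hle,
    det_eq_pow_of_isNilpotent (t := t), det_eq_pow_of_isNilpotent (t := 1), one_pow, mul_one]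
  · refine ⟨Module.finrank K V, LinearMap.ext fun v => ?_⟩
    obtain ⟨v, rfl⟩ := (Module.End.maxGenEigenspace A t).mkQ_surjective v
    obtain ⟨v₁, hv₁, v₂, hv₂, rfl⟩ := Submodule.mem_sup.1 (hsup ▸ Submodule.mem_top :
      v ∈ Module.End.maxGenEigenspace A 1 ⊔ Module.End.maxGenEigenspace A t)
    have hsemi : ∀ w, (Module.End.maxGenEigenspace A t).mkQ ((A - (1 : K) • 1) w) =
        (Submodule.mapQ _ _ A hle - (1 : K) • 1) ((Module.End.maxGenEigenspace A t).mkQ w) :=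
      fun w => rfl
    rw [map_add, Submodule.mkQ_apply _ v₂, (Submodule.Quotient.mk_eq_zero _).2 hv₂, add_zero,
      LinearMap.zero_apply, ← map_pow_apply_of_semiconj hsemi]
    rw [Module.End.maxGenEigenspace_eq_genEigenspace_finrank, Module.End.mem_genEigenspace_nat]
      at hv₁
    rw [LinearMap.mem_ker.1 hv₁, map_zero]
  · refine ⟨Module.finrank K V, LinearMap.ext fun v => Subtype.ext ?_⟩
    have hsemi : ∀ w : Module.End.maxGenEigenspace A t,
        (((A.restrict hle - t • (1 : Module.End K (Module.End.maxGenEigenspace A t)) :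
          Module.End K (Module.End.maxGenEigenspace A t)) w : Module.End.maxGenEigenspace A t) : V) =
        (A - t • (1 : Module.End K V)) w := fun w => rfl
    rw [map_pow_apply_of_semiconj (T := Subtype.val) hsemi]
    obtain ⟨v, hv⟩ := v
    rw [Module.End.maxGenEigenspace_eq_genEigenspace_finrank, Module.End.mem_genEigenspace_nat]
      at hv
    exact LinearMap.mem_ker.1 hv

/-- Differences `ρ g x - x` lie in `S` and include a small multiple of every vector of `ker e`;
together with `x` these span `V`. -/
theorem IsRadiallyOpenAt.eq_top {G V : Type*} [Group G] [AddCommGroup V] [Module ℝ V]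
    {ρ : Representation ℝ G V} {e : Module.Dual ℝ V} {x : V} (hx : ρ.IsRadiallyOpenAt e x)
    (hex : e x ≠ 0) {S : Submodule ℝ V} (hS : ρ.IsStable S) (hxS : x ∈ S) : S = ⊤ := by
  rw [eq_top_iff]
  intro v _
  obtain ⟨ε, hε, h⟩ := hx (v - (e v / e x) • x) (by simp [hex])
  obtain ⟨g, hg⟩ := h (ε / 2) (by rw [abs_of_pos (by positivity)]; linarith)
  have h1 : (ε / 2) • (v - (e v / e x) • x) ∈ S := by
    rw [← add_sub_cancel_left x ((ε / 2) • (v - (e v / e x) • x)), ← hg]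
    exact S.sub_mem (hS g hxS) hxS
  have h2 := (S.smul_mem_iff (by positivity)).1 h1
  simpa using S.add_mem h2 (S.smul_mem (e v / e x) hxS)

theorem isUnipotent_of_forall_maxGenEigenspace {k G V : Type*} [Field k] [Group G]
    [AddCommGroup V] [Module k V] {ρ : Representation k G V}
    (h : ∀ g, Module.End.maxGenEigenspace (ρ g) 1 = ⊤) : ρ.IsUnipotent := by
  intro g v
  have hv : v ∈ Module.End.maxGenEigenspace (ρ g) 1 := h g ▸ Submodule.mem_top
  simpa using (Module.End.mem_maxGenEigenspace _ _ _).1 hv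

theorem isCompl_maxGenEigenspace_iInf_range_pow {K V : Type*} [Field K] [AddCommGroup V]
    [Module K V] [FiniteDimensional K V] (A : Module.End K V) :
    IsCompl (Module.End.maxGenEigenspace A 1) (⨅ k : ℕ, LinearMap.range ((A - 1) ^ k)) := by
  have h := LinearMap.isCompl_iSup_ker_pow_iInf_range_pow (A - 1)
  have hker : ⨆ k : ℕ, LinearMap.ker ((A - 1) ^ k) = Module.End.maxGenEigenspace A 1 := by
    rw [← Module.End.iSup_genEigenspace_eq]
    simp only [Module.End.genEigenspace_nat, one_smul]
  rwa [hker] at h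

/-! ### Criteria for unipotence. -/

variable {G : Type*} [Group G] [TopologicalSpace G] [IsTopologicalGroup G] [ConnectedSpace G]
  [Group.IsNilpotent G] {V : Type*} [AddCommGroup V] [Module ℝ V] [FiniteDimensional ℝ V]
  {ρ : Representation ℝ G V}

/-- A connected nilpotent group of transformations that preserves a functional and acts
transitively on an affine hyperplane on which the functional is constant is unipotent. -/
theorem isUnipotent_of_transitive (hρ : ρ.IsWeaklyContinuous) {e : Module.Dual ℝ V}
    (he : ∀ g v, e (ρ g v) = e v) {x : V} (hex : e x ≠ 0)
    (htr : ∀ y z, e y = e x → e z = e x → ∃ g, ρ g y = z) : ρ.IsUnipotent := by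
  refine isUnipotent_of_forall_maxGenEigenspace fun z => ?_
  obtain ⟨x₁, hx₁, x₂, hx₂, hxx⟩ := Submodule.mem_sup.1
    ((isCompl_maxGenEigenspace_iInf_range_pow (ρ z)).sup_eq_top ▸ Submodule.mem_top : x ∈ _)
  have he₂ : e x₂ = 0 := by
    obtain ⟨u, rfl⟩ := (Submodule.mem_iInf _).1 hx₂ 1
    simp [he]
  have he₁ : e x₁ = e x := by rw [← hxx, map_add, he₂, add_zero]
  have hopen : ρ.IsRadiallyOpenAt e x₁ := fun w hw =>
    ⟨1, one_pos, fun s _ => htr _ _ he₁ (by rw [map_add, map_smul, hw, smul_zero, add_zero, he₁])⟩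
  exact hopen.eq_top (he₁ ▸ hex) (isStable_maxGenEigenspace hρ z 1) hx₁

/-- A connected nilpotent group of transformations of determinant one that preserves a functional
and has an orbit open in an affine hyperplane is unipotent. -/
theorem isUnipotent_of_det_eq_one (hρ : ρ.IsWeaklyContinuous) {e : Module.Dual ℝ V}
    (he : ∀ g v, e (ρ g v) = e v) {x : V} (hx : ρ.IsRadiallyOpenAt e x) (hex : e x ≠ 0)
    (hdet : ∀ g, LinearMap.det (ρ g) = 1) : ρ.IsUnipotent := by
  refine isUnipotent_of_forall_maxGenEigenspace fun z => ?_
  have hcompl := isCompl_maxGenEigenspace_iInf_range_pow (ρ z)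
  have h₁ := isStable_maxGenEigenspace hρ z 1
  have h₂ := isStable_iInf_range_pow hρ z
  set V₁ := Module.End.maxGenEigenspace (ρ z) 1
  set V₂ := ⨅ k : ℕ, LinearMap.range ((ρ z - 1) ^ k)
  obtain ⟨x₁, hx₁, x₂, hx₂, hxx⟩ := Submodule.mem_sup.1
    (hcompl.sup_eq_top ▸ Submodule.mem_top : x ∈ V₁ ⊔ V₂)
  by_cases hx₂0 : x₂ = 0
  · refine hx.eq_top hex h₁ ?_
    rw [← hxx, hx₂0, add_zero]
    exact hx₁
  exfalso
  have he₂ : e x₂ = 0 := by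
    obtain ⟨u, rfl⟩ := (Submodule.mem_iInf _).1 hx₂ 1
    simp [he]
  -- Choose `g` taking `x₁ + x₂` to `x₁ + (1 + ε / 2) • x₂`. Comparing components in the stable
  -- summands, `g` fixes `x₁` and scales `x₂`.
  obtain ⟨ε, hε, h⟩ := hx x₂ he₂
  obtain ⟨g, hg⟩ := h (ε / 2) (by rw [abs_of_pos (by positivity)]; linarith)
  have hd : ρ g x₁ - x₁ = (1 + ε / 2) • x₂ - ρ g x₂ := by
    rw [← hxx, map_add] at hg
    rw [sub_eq_sub_iff_add_eq_add, hg, add_smul, one_smul]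
    abel
  have h0 : ρ g x₁ - x₁ = 0 := by
    refine Submodule.disjoint_def.1 hcompl.disjoint _ (V₁.sub_mem (h₁ g hx₁) hx₁) ?_
    rw [hd]
    exact V₂.sub_mem (V₂.smul_mem _ hx₂) (h₂ g hx₂)
  have hg₁ : x₁ ∈ Module.End.maxGenEigenspace (ρ g) 1 :=
    (Module.End.mem_maxGenEigenspace _ _ _).2 ⟨1, by simpa using h0⟩
  have hg₂ : x₂ ∈ Module.End.maxGenEigenspace (ρ g) (1 + ε / 2) := by
    refine (Module.End.mem_maxGenEigenspace _ _ _).2 ⟨1, ?_⟩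
    rw [h0] at hd
    rw [pow_one, LinearMap.sub_apply, LinearMap.smul_apply, Module.End.one_apply,
      sub_eq_zero.1 hd.symm, sub_self]
  have hsup : Module.End.maxGenEigenspace (ρ g) 1 ⊔
      Module.End.maxGenEigenspace (ρ g) (1 + ε / 2) = ⊤ := by
    refine hx.eq_top hex (fun g' => ?_) (hxx ▸ Submodule.add_mem_sup hg₁ hg₂)
    refine sup_le ?_ ?_
    · exact (isStable_maxGenEigenspace hρ g 1 g').trans (Submodule.comap_mono le_sup_left)
    · exact (isStable_maxGenEigenspace hρ g _ g').trans (Submodule.comap_mono le_sup_right)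
  have hdet' := det_eq_pow_of_maxGenEigenspace hsup
  rw [hdet] at hdet'
  have hpos : Module.finrank ℝ (Module.End.maxGenEigenspace (ρ g) (1 + ε / 2)) ≠ 0 := by
    intro h
    rw [Submodule.finrank_eq_zero] at h
    rw [h] at hg₂
    exact hx₂0 ((Submodule.mem_bot ℝ).1 hg₂)
  exact (one_lt_pow₀ (by linarith : 1 < 1 + ε / 2) hpos).ne hdet'

end Representation

/-! ### From affine to linear representations. -/

namespace AffineRep

variable {G : Type*} [Group G] {n : ℕ}

/-- The embedding `x ↦ (x, 1)` of affine space as a hyperplane. -/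
def embed (x : Space n) : Fin (n + 1) → ℝ :=
  Sum.elim x (fun _ : Fin 1 => 1) ∘ finSumFinEquiv.symm

/-- The last coordinate, which is constant on the image of affine space. -/
def lastCoord (n : ℕ) : Module.Dual ℝ (Fin (n + 1) → ℝ) :=
  LinearMap.proj (finSumFinEquiv (Sum.inr (0 : Fin 1)))

theorem lastCoord_embed (x : Space n) : lastCoord n (embed x) = 1 := by
  simp [lastCoord, embed, -finSumFinEquiv_apply_right]

theorem embed_injective : Function.Injective (embed (n := n)) := by
  intro x y h
  ext i
  have := congrFun h (finSumFinEquiv (Sum.inl i))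
  simpa [embed, -finSumFinEquiv_apply_left] using this

theorem exists_embed_eq {v : Fin (n + 1) → ℝ} (hv : lastCoord n v = 1) : ∃ x, embed x = v := by
  refine ⟨WithLp.toLp 2 fun i => v (finSumFinEquiv (Sum.inl i)), ?_⟩
  funext k
  obtain ⟨k | k, rfl⟩ := finSumFinEquiv.surjective k
  · simp [embed, -finSumFinEquiv_apply_left]
  · rw [Subsingleton.elim k 0]
    have : v (finSumFinEquiv (Sum.inr 0)) = 1 := hv
    simp [embed, this, -finSumFinEquiv_apply_right]

theorem exists_embed_add_smul {w : Fin (n + 1) → ℝ} (hw : lastCoord n w = 0) (x : Space n) :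
    ∃ u : Space n, ∀ s : ℝ, embed (x + s • u) = embed x + s • w := by
  refine ⟨WithLp.toLp 2 fun i => w (finSumFinEquiv (Sum.inl i)), fun s => ?_⟩
  funext k
  obtain ⟨k | k, rfl⟩ := finSumFinEquiv.surjective k
  · simp [embed, -finSumFinEquiv_apply_left]
  · rw [Subsingleton.elim k 0]
    have : w (finSumFinEquiv (Sum.inr 0)) = 0 := hw
    simp [embed, this, -finSumFinEquiv_apply_right]

theorem toMatrix_mulVec_embed (A : Aff n) (x : Space n) :
    (toMatrix A).mulVec (embed x) = embed (A x) := by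
  rw [toMatrix, Matrix.reindex_apply, Matrix.submatrix_mulVec_equiv, embed, embed,
    Function.comp_assoc]
  simp only [Equiv.symm_symm, Equiv.symm_comp_self, Function.comp_id]
  congr 1
  rw [Matrix.fromBlocks_mulVec]
  simp only [Sum.elim_comp_inl, Sum.elim_comp_inr]
  congr 1
  · funext i
    rw [apply_eq_linear_add A x, PiLp.add_apply, linear_apply_eq_sum]
    simp [Matrix.mulVec, dotProduct]
  · simp

theorem lastCoord_toMatrix_mulVec (A : Aff n) (v : Fin (n + 1) → ℝ) :
    lastCoord n ((toMatrix A).mulVec v) = lastCoord n v := by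
  rw [toMatrix, Matrix.reindex_apply, Matrix.submatrix_mulVec_equiv, Matrix.fromBlocks_mulVec]
  simp [lastCoord, -finSumFinEquiv_apply_right]

theorem det_toMatrix (A : Aff n) :
    (toMatrix A).det = LinearMap.det (A.linear : Space n →ₗ[ℝ] Space n) := by
  rw [toMatrix, Matrix.det_reindex_self, Matrix.det_fromBlocks_zero₂₁, Matrix.det_one, mul_one,
    ← LinearMap.det_toMatrix (EuclideanSpace.basisFun (Fin n) ℝ).toBasis]
  congr 1

/-- The linear representation of degree `n + 1` attached to an affine representation. -/
noncomputable def linearization (ρ : G →* Aff n) : Representation ℝ G (Fin (n + 1) → ℝ) :=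
  (Matrix.toLinAlgEquiv' : Matrix (Fin (n + 1)) (Fin (n + 1)) ℝ ≃ₐ[ℝ] _).toMonoidHom.comp
    ((Units.coeHom _).comp ((toGL n).comp ρ))

theorem linearization_eq_toLin' (ρ : G →* Aff n) (g : G) :
    linearization ρ g = Matrix.toLin' (toMatrix (ρ g)) := rfl

theorem lastCoord_linearization (ρ : G →* Aff n) (g : G) (v : Fin (n + 1) → ℝ) :
    lastCoord n (linearization ρ g v) = lastCoord n v :=
  lastCoord_toMatrix_mulVec _ _

theorem linearization_embed (ρ : G →* Aff n) (g : G) (x : Space n) :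
    linearization ρ g (embed x) = embed (ρ g x) :=
  toMatrix_mulVec_embed _ _

theorem isVolumePreserving_iff (ρ : G →* Aff n) :
    IsVolumePreserving ρ ↔ ∀ g, LinearMap.det (linearization ρ g) = 1 := by
  refine forall_congr' fun g => ?_
  rw [linearization_eq_toLin', LinearMap.det_toLin', det_toMatrix]

theorem isTransitive_iff (ρ : G →* Aff n) :
    IsTransitive ρ ↔ ∀ v w, lastCoord n v = 1 → lastCoord n w = 1 →
      ∃ g, linearization ρ g v = w := by
  constructor
  · intro h v w hv hw
    obtain ⟨x, rfl⟩ := exists_embed_eq hv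
    obtain ⟨y, rfl⟩ := exists_embed_eq hw
    obtain ⟨g, hg⟩ := h x y
    exact ⟨g, by rw [linearization_embed, hg]⟩
  · intro h x y
    obtain ⟨g, hg⟩ := h _ _ (lastCoord_embed x) (lastCoord_embed y)
    rw [linearization_embed] at hg
    exact ⟨g, embed_injective hg⟩

/-- The open orbit pulls back along `s ↦ x + s • u` to an open set of reals containing `0`. -/
theorem IsPrehomogeneous.exists_isRadiallyOpenAt {ρ : G →* Aff n} (hρ : IsPrehomogeneous ρ) :
    ∃ x : Space n, (linearization ρ).IsRadiallyOpenAt (lastCoord n) (embed x) := by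
  obtain ⟨x, hx⟩ := hρ
  refine ⟨x, fun w hw => ?_⟩
  obtain ⟨u, hu⟩ := exists_embed_add_smul hw x
  have hc : Continuous fun s : ℝ => x + s • u := by fun_prop
  obtain ⟨ε, hε, h⟩ := Metric.isOpen_iff.1 (hx.preimage hc) 0 ⟨1, by simp⟩
  refine ⟨ε, hε, fun s hs => ?_⟩
  obtain ⟨g, hg⟩ := h (by simpa using hs : s ∈ Metric.ball 0 ε)
  exact ⟨g, by rw [linearization_embed, ← hu]; exact congrArg embed hg⟩

theorem isWeaklyContinuous_linearization [TopologicalSpace G] {ρ : G →* Aff n}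
    (h : ∀ i j, Continuous fun g => (toGL n (ρ g)).val i j) :
    (linearization ρ).IsWeaklyContinuous := by
  intro f v
  have hc : Continuous fun g => (linearization ρ g) v := by
    refine continuous_pi fun i => ?_
    change Continuous fun g => ∑ j, (toGL n (ρ g)).val i j * v j
    exact continuous_finsetSum _ fun j _ => (h i j).mul continuous_const
  exact f.continuous_of_finiteDimensional.comp hc

/-- Conjugation preserves the characteristic polynomial `(X - 1) ^ (n + 1)`; apply Cayley–Hamilton.
-/
theorem isUnipotent_linearization {ρ : G →* Aff n}
    (h : IsUnipotent (ρ.range.map (toGL n))) : (linearization ρ).IsUnipotent := by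
  obtain ⟨P, hP⟩ := h
  intro g v
  obtain ⟨hdiag, hlow⟩ := hP (toGL n (ρ g)) ⟨ρ g, ⟨g, rfl⟩, rfl⟩
  refine ⟨n + 1, ?_⟩
  have hchar := Matrix.charpoly_of_isUpperTriangular (P * toGL n (ρ g) * P⁻¹).val
    (fun i j hij => hlow i j hij)
  simp only [hdiag, Finset.prod_const, Finset.card_univ, Fintype.card_fin] at hchar
  rw [Units.val_mul, Units.val_mul, Matrix.coe_units_inv, Matrix.charpoly_units_conj] at hchar
  have hCH := Matrix.aeval_self_charpoly (toGL n (ρ g)).val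
  rw [hchar] at hCH
  have hpow : (linearization ρ g - 1) ^ (n + 1) =
      Matrix.toLinAlgEquiv' (((toGL n (ρ g)).val - 1) ^ (n + 1)) := by
    rw [map_pow, map_sub, map_one]
    rfl
  rw [hpow]
  simp only [map_pow, map_sub, Polynomial.aeval_X, map_one] at hCH
  rw [hCH, map_zero, LinearMap.zero_apply]

theorem isUnipotent_of_linearization [Group.IsNilpotent G] {ρ : G →* Aff n}
    (h : (linearization ρ).IsUnipotent) : IsUnipotent (ρ.range.map (toGL n)) := by
  obtain ⟨b, hb⟩ := h.exists_basis (n := n + 1) (by simp)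
  let c := Pi.basisFun ℝ (Fin (n + 1))
  -- `P` passes from standard coordinates to those of the flag basis `b`.
  let P : GL (Fin (n + 1)) ℝ :=
    ⟨b.toMatrix c, c.toMatrix b, b.toMatrix_mul_toMatrix_flip c, c.toMatrix_mul_toMatrix_flip b⟩
  have key : ∀ g, (P * toGL n (ρ g) * P⁻¹).val = LinearMap.toMatrix b b (linearization ρ g) := by
    intro g
    rw [← basis_toMatrix_mul_linearMap_toMatrix_mul_basis_toMatrix b c b c]
    change _ * toMatrix (ρ g) * _ = _
    rw [linearization_eq_toLin', ← Matrix.toLin_eq_toLin', LinearMap.toMatrix_toLin]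
    rfl
  have hcoord : ∀ g i j, j ≤ i → b.repr (linearization ρ g (b j) - b j) i = 0 := by
    intro g i j hij
    have := b.mem_span_image.1 (hb g j)
    by_contra hne
    exact absurd (this (Finsupp.mem_support_iff.2 hne)) (not_lt.2 hij)
  refine ⟨P, ?_⟩
  rintro _ ⟨_, ⟨g, rfl⟩, rfl⟩
  refine ⟨fun i => ?_, fun i j hij => ?_⟩
  · have := hcoord g i i le_rfl
    rw [map_sub, Finsupp.sub_apply, sub_eq_zero, b.repr_self, Finsupp.single_eq_same] at this
    rw [key, LinearMap.toMatrix_apply, this]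
  · have := hcoord g i j hij.le
    rw [map_sub, Finsupp.sub_apply, sub_eq_zero, b.repr_self,
      Finsupp.single_eq_of_ne hij.ne'] at this
    rw [key, LinearMap.toMatrix_apply, this]

theorem IsUnipotent.isVolumePreserving {ρ : G →* Aff n}
    (h : IsUnipotent (ρ.range.map (toGL n))) : IsVolumePreserving ρ := by
  obtain ⟨P, hP⟩ := h
  intro g
  obtain ⟨hdiag, hlow⟩ := hP (toGL n (ρ g)) ⟨ρ g, ⟨g, rfl⟩, rfl⟩
  have hdet := Matrix.det_of_isUpperTriangular (M := (P * toGL n (ρ g) * P⁻¹).val)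
    (fun i j hij => hlow i j hij)
  simp only [hdiag, Finset.prod_const_one] at hdet
  rw [Units.val_mul, Units.val_mul, Matrix.det_units_conj] at hdet
  rw [← det_toMatrix]
  exact hdet

end AffineRep

theorem mainTheorem2 {E : Type*} [NormedAddCommGroup E] [NormedSpace ℝ E] [FiniteDimensional ℝ E]
    {G : Type*} [Group G] [TopologicalSpace G] [ChartedSpace E G] [LieGroup 𝓘(ℝ, E) ∞ G]
    [ConnectedSpace G] [Group.IsNilpotent G]
    (n : ℕ) (ρ : G →* AffineRep.Aff n)
    (hsmooth : AffineRep.IsSmooth (E := E) ρ) (hρ : AffineRep.IsPrehomogeneous ρ) :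
    List.TFAE
      [AffineRep.IsTransitive ρ,
        AffineRep.IsUnipotent (ρ.range.map (AffineRep.toGL n)),
        AffineRep.IsVolumePreserving ρ] := by
  have : IsTopologicalGroup G := topologicalGroup_of_lieGroup 𝓘(ℝ, E) ∞
  have hcont := AffineRep.isWeaklyContinuous_linearization fun i j => (hsmooth i j).continuous
  have he := AffineRep.lastCoord_linearization ρ
  obtain ⟨x, hx⟩ := hρ.exists_isRadiallyOpenAt
  have hex := AffineRep.lastCoord_embed x
  tfae_have 1 → 2 := fun h => AffineRep.isUnipotent_of_linearization <|
    Representation.isUnipotent_of_transitive hcont he (x := AffineRep.embed x)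
      (by simp [hex]) (by simpa only [hex] using (AffineRep.isTransitive_iff ρ).1 h)
  tfae_have 2 → 3 := AffineRep.IsUnipotent.isVolumePreserving
  tfae_have 3 → 2 := fun h => AffineRep.isUnipotent_of_linearization <|
    Representation.isUnipotent_of_det_eq_one hcont he hx (by simp [hex])
      ((AffineRep.isVolumePreserving_iff ρ).1 h)
  tfae_have 2 → 1 := by
    intro h
    have hreach : ∀ v, AffineRep.lastCoord n v = 1 →
        ∃ g, AffineRep.linearization ρ g (AffineRep.embed x) = v := by
      intro v hv
      obtain ⟨g, hg⟩ := (AffineRep.isUnipotent_linearization h).exists_apply_eq_add _ rfl he hx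
        (w := v - AffineRep.embed x) (by rw [map_sub, hv, hex, sub_self])
      exact ⟨g, by rw [hg, add_sub_cancel]⟩
    refine (AffineRep.isTransitive_iff ρ).2 fun v w hv hw => ?_
    obtain ⟨g, rfl⟩ := hreach v hv
    obtain ⟨g', rfl⟩ := hreach w hw
    exact ⟨g' * g⁻¹, by rw [← Representation.apply_mul, inv_mul_cancel_right]⟩
  tfae_finish
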